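/- For a graph $G$ and a graph $F$, let $c(G,F)$ denote the minimum number $k$ of colors for which the edges of $G$ can be colored with $k$ colors so that there is no monochromatic copy of $F$ (as a not necessarily induced subgraph). Let $P_{n+1}$ be the path on $n+1$ vertices, and let $G(N,p)$ be the binomial random graph on $N$ vertices with edge probability $p$. Let $N=N(n)$ be integers with $N>n$, let $p=p(n)\in[0,1]$, and put $r=N/n$. Suppose that $pN^2\to\infty$ as $n\to\infty$ (for instance, $p\ge 1/N$) and that, for all sufficiently large $n$, $$p\le \frac{\log r}{34\,n},$$ where $\log$ is the natural logarithm. Then, with probability tending to $1$ as $n\to\infty$, $$c\bigl(G(N,p),P_{n+1}\bigr)\ \ge\ \frac{\log\omega}{24\,\omega}\,r,\qquad\text{where } \omega=\frac{\log r}{np}.$$ -/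

import Mathlib

open Filter Topology
open scoped unitInterval

/-- `c(G, F)`: the minimum number `k` of colours such that the edges of `G` can be coloured
with `k` colours without a monochromatic copy of `F` (every colour class is `F`-free; edge
colourings need not be proper). The set of such `k` is nonempty whenever `G` is finite and `F` has
at least two edges. -/
noncomputable def SimpleGraph.minColors {V W : Type*} (G : SimpleGraph V) (F : SimpleGraph W) : ℕ :=
  sInf {k : ℕ | ∃ C : G.EdgeLabeling (Fin k), ∀ i : Fin k, F.Free (C.labelGraph i)}

/-! Edges are counted: with high probability G has more than pN(N-1)/4 edges, half the mean, while
every colour class has at most M = (11/2) N log r / log ω. Dividing gives the bound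
(`ncard_edgeSet_le_minColors_mul`).

M has to bound all P_{n+1}-free subgraphs at once. The stack of a depth-first search is a path, so
in a P_{n+1}-free graph the finished vertices have at most n outside neighbours, all on the stack.
Cut the finishing order into about r blocks of n vertices and record, for each block, the outer
boundary of the initial segment it ends. These data confine the edges to a container of at most 2nN
pairs, and up to lower-order terms in the exponent there are at most exp(2N log r) containers
(`exists_containers`). A container has at most 2npN = 2N log r / ω edges on average, so by Chernoff
it reaches M with probability at most exp(-(47/20) N log r), and the union bound succeeds.

For r < 120 the claimed bound is below 1, and a single edge of G suffices. -/

open Classical in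
/-- The vertices outside the list `D` that are adjacent to a vertex of `D`. -/
noncomputable def SimpleGraph.outerBoundary {V : Type*} [Fintype V] (H : SimpleGraph V)
    (D : List V) : Finset V :=
  {v | v ∉ D ∧ ∃ u ∈ D, H.Adj u v}

namespace SimpleGraph

/-! ### Depth-first search and vertex separation. -/

section DepthFirstSearch

variable {V : Type*} {H : SimpleGraph V} {n : ℕ}

lemma length_le_of_pathGraph_free (hH : (pathGraph (n + 1)).Free H) {l : List V}
    (hl : l.IsChain H.Adj) (hd : l.Nodup) : l.length ≤ n := by
  by_contra! hlen
  refine hH ⟨⟨⟨fun i => l[i.val]'(by omega), ?_⟩, ?_⟩⟩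
  · intro i j hij
    rw [List.isChain_iff_getElem] at hl
    rcases pathGraph_adj.1 hij with h | h
    · have := hl i.val (by omega)
      simpa [h] using this
    · have := hl j.val (by omega)
      simpa [h] using this.symm
  · intro i j hij
    exact Fin.ext ((hd.getElem_inj_iff).1 hij)

variable [Fintype V]

/-- Depth-first search, started with the finished vertices `L` and the stack `P`: if every path has
at most `n` vertices, the order in which the vertices are finished has small boundaries. -/
lemma exists_order_of_dfs_state (hn : ∀ l : List V, l.IsChain H.Adj → l.Nodup → l.length ≤ n)
    (k : ℕ) : ∀ L P : List V, 2 * Fintype.card V = 2 * L.length + P.length + k →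
      (P ++ L).Nodup → P.IsChain H.Adj →
      (∀ u ∈ L, ∀ v, H.Adj u v → v ∈ P ++ L) →
      (∀ m, (H.outerBoundary (L.take m)).card ≤ n) →
      ∃ L' : List V, L'.Nodup ∧ (∀ v, v ∈ L') ∧ ∀ m, (H.outerBoundary (L'.take m)).card ≤ n := by
  classical
  -- `k` counts the remaining moves: every vertex is pushed once and popped once.
  induction k using Nat.strong_induction_on with
  | _ k ih =>
  intro L P hk hd hP hL hB
  have hcard := hd.length_le_card
  rw [List.length_append] at hcard
  have push : ∀ v, v ∉ P ++ L → (v :: P).IsChain H.Adj →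
      ∃ L' : List V, L'.Nodup ∧ (∀ v, v ∈ L') ∧ ∀ m, (H.outerBoundary (L'.take m)).card ≤ n := by
    intro v hv hc
    have hd' : (v :: P ++ L).Nodup := by simpa using ⟨by simpa using hv, by simpa using hd⟩
    have hcard' := hd'.length_le_card
    simp only [List.cons_append, List.length_cons, List.length_append] at hcard'
    refine ih (k - 1) (by omega) L (v :: P) (by simp only [List.length_cons]; omega) hd' hc ?_ hB
    intro u hu w hw
    exact List.mem_cons_of_mem _ (hL u hu w hw)
  match P, hk, hd, hP, hL, hcard, push with
  | [], hk, hd, hP, hL, hcard, push =>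
    by_cases h : ∀ v, v ∈ L
    · exact ⟨L, by simpa using hd, h, hB⟩
    · push Not at h
      obtain ⟨v, hv⟩ := h
      exact push v (by simpa using hv) (by simp)
  | a :: P, hk, hd, hP, hL, hcard, push =>
    by_cases h : ∃ v, v ∉ a :: P ++ L ∧ H.Adj a v
    · obtain ⟨v, hv, hav⟩ := h
      exact push v hv (by simpa [List.isChain_cons_cons] using ⟨hav.symm, hP⟩)
    · push Not at h
      simp only [List.length_cons] at hk hcard
      have hd' : (P ++ (L ++ [a])).Nodup := by
        have hperm : (P ++ (L ++ [a])).Perm (a :: P ++ L) := by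
          rw [← List.append_assoc]
          exact List.perm_append_comm
        exact hperm.nodup_iff.2 hd
      have hP' : P.IsChain H.Adj := hP.tail
      have hL' : ∀ u ∈ L ++ [a], ∀ v, H.Adj u v → v ∈ P ++ (L ++ [a]) := by
        intro u hu v huv
        have hmem : v ∈ a :: P ++ L := by
          rcases List.mem_append.1 hu with hu | hu
          · exact hL u hu v huv
          · by_contra hv
            rw [List.mem_singleton] at hu
            exact h v hv (hu ▸ huv)
        simp only [List.cons_append, List.mem_cons, List.mem_append] at hmem ⊢
        tauto
      refine ih (k - 1) (by omega) (L ++ [a]) P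
        (by simp only [List.length_append, List.length_singleton]; omega) hd' hP' hL' ?_
      intro m
      -- Only the full list is a new prefix. Its neighbours are finished or on the stack `P`, a
      -- path, so its boundary lies in `P`.
      rcases le_or_gt m L.length with hm | hm
      · rw [List.take_append_of_le_length hm]
        exact hB m
      · rw [List.take_of_length_le (by simpa using hm)]
        refine le_trans (Finset.card_le_card (t := P.toFinset) ?_)
          ((List.toFinset_card_le P).trans (hn P hP' (List.Nodup.of_append_left hd')))
        intro v hv
        simp only [outerBoundary, Finset.mem_filter, Finset.mem_univ, true_and] at hv
        obtain ⟨hv, u, hu, huv⟩ := hv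
        exact List.mem_toFinset.2 ((List.mem_append.1 (hL' u hu v huv)).resolve_right hv)

/-- A graph without a path on `n + 1` vertices has vertex separation number at most `n`. -/
lemma exists_order_of_pathGraph_free (hH : (pathGraph (n + 1)).Free H) :
    ∃ L : List V, L.Nodup ∧ (∀ v, v ∈ L) ∧ ∀ m, (H.outerBoundary (L.take m)).card ≤ n :=
  exists_order_of_dfs_state (fun _ hl hd => length_le_of_pathGraph_free hH hl hd)
    (2 * Fintype.card V) [] [] (by simp) (by simp) (by simp) (by simp) (by simp [outerBoundary])

end DepthFirstSearch

/-! ### Containers for path-free graphs. -/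

section Containers

variable {V : Type*} [Fintype V] {n : ℕ}

/-- If `H` has no path on `n + 1` vertices, its vertices can be divided into blocks of at most `n`
vertices so that every edge leaving a block from its earlier end enters a set of at most `n`
vertices attached to that block. -/
lemma exists_blocks_of_pathGraph_free {H : SimpleGraph V} (hn : 0 < n)
    (hH : (pathGraph (n + 1)).Free H) {b : ℕ} (hb : Fintype.card V ≤ b * n) :
    ∃ (f : V → Fin b) (S : Fin b → {s : Finset V // s.card ≤ n}),
      (∀ i, (Finset.univ.filter (f · = i)).card ≤ n) ∧
      ∀ u v, H.Adj u v → (f u = f v ∨ v ∈ (S (f u)).1) ∨ (f v = f u ∨ u ∈ (S (f v)).1) := by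
  classical
  obtain ⟨L, hd, hmem, hB⟩ := exists_order_of_pathGraph_free hH
  have hlen : L.length ≤ b * n := hd.length_le_card.trans hb
  have hidx : ∀ v, L.idxOf v < L.length := fun v => List.idxOf_lt_length_iff.2 (hmem v)
  have hinj : ∀ u v, L.idxOf u = L.idxOf v → u = v := fun u v h =>
    (List.idxOf_inj (hmem u)).1 h
  have hlt : ∀ v, L.idxOf v / n < b := fun v =>
    (Nat.div_lt_iff_lt_mul hn).2 ((hidx v).trans_le hlen)
  -- Block `i` holds positions `i * n` to `(i + 1) * n - 1`; its attached set is the boundary of the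
  -- prefix ending with that block.
  refine ⟨fun v => ⟨L.idxOf v / n, hlt v⟩,
    fun i => ⟨H.outerBoundary (L.take ((i.val + 1) * n)), hB _⟩, ?_, ?_⟩
  · intro i
    calc _ ≤ (Finset.Ico (i.val * n) ((i.val + 1) * n)).card := by
          refine Finset.card_le_card_of_injOn (fun v => L.idxOf v) ?_ ?_
          · intro v hv
            simp only [Finset.coe_filter, Finset.mem_univ, true_and, Set.mem_ofPred_eq,
              Fin.ext_iff] at hv
            simp only [Finset.coe_Ico, Set.mem_Ico]
            exact ⟨(Nat.le_div_iff_mul_le hn).1 hv.ge,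
              (Nat.div_lt_iff_lt_mul hn).1 (by omega)⟩
          · intro u _ v _ h
            exact hinj u v h
      _ = n := by rw [Nat.card_Ico, add_mul, one_mul, Nat.add_sub_cancel_left]
  · have key : ∀ u v, H.Adj u v → L.idxOf u / n < L.idxOf v / n →
        v ∈ H.outerBoundary (L.take ((L.idxOf u / n + 1) * n)) := by
      intro u v huv h
      have hmemtake : ∀ w m, w ∈ L.take m ↔ L.idxOf w < m := by
        intro w m
        rw [List.mem_take_iff_idxOf_lt (hmem w)]
      simp only [outerBoundary, Finset.mem_filter, Finset.mem_univ, true_and]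
      refine ⟨?_, u, ?_, huv⟩
      · rw [hmemtake, not_lt]
        exact (Nat.le_div_iff_mul_le hn).1 h
      · rw [hmemtake]
        exact (Nat.div_lt_iff_lt_mul hn).1 (Nat.lt_succ_self _)
    intro u v huv
    rcases lt_trichotomy (L.idxOf u / n) (L.idxOf v / n) with h | h | h
    · exact .inl (.inr (key u v huv h))
    · exact .inl (.inl (Fin.ext h))
    · exact .inr (.inr (key v u huv.symm h))

/-- A small family of small sets of pairs such that every graph without a path on `n + 1` vertices
has its edge set contained in a member of the family. -/
lemma exists_containers (V : Type*) [Fintype V] {n b : ℕ} (hn : 0 < n)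
    (hb : Fintype.card V ≤ b * n) :
    ∃ 𝓔 : Finset (Finset (Sym2 V)),
      𝓔.card ≤ b ^ Fintype.card V * Fintype.card {s : Finset V // s.card ≤ n} ^ b ∧
      (∀ E ∈ 𝓔, E.card ≤ 2 * n * Fintype.card V ∧ ∀ e ∈ E, ¬ e.IsDiag) ∧
      ∀ H : SimpleGraph V, (pathGraph (n + 1)).Free H → ∃ E ∈ 𝓔, H.edgeSet ⊆ E := by
  classical
  let T := (V → Fin b) × (Fin b → {s : Finset V // s.card ≤ n})
  let pairs : T → Finset (V × V) := fun t =>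
    Finset.univ.filter fun q => q.1 ≠ q.2 ∧ (t.1 q.1 = t.1 q.2 ∨ q.2 ∈ (t.2 (t.1 q.1)).1)
  let Φ : T → Finset (Sym2 V) := fun t => (pairs t).image fun q => s(q.1, q.2)
  -- An arbitrary `f` may have large blocks, so the size bound is imposed by filtering; containers
  -- built from a path-free graph survive.
  refine ⟨(Finset.univ.image Φ).filter (fun E => E.card ≤ 2 * n * Fintype.card V), ?_, ?_, ?_⟩
  · refine (Finset.card_filter_le _ _).trans (Finset.card_image_le.trans ?_)
    simp [T, Finset.card_univ]
  · intro E hE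
    simp only [Finset.mem_filter, Finset.mem_image, Finset.mem_univ, true_and] at hE
    obtain ⟨⟨t, rfl⟩, hE⟩ := hE
    refine ⟨hE, fun e he => ?_⟩
    simp only [Φ, pairs, Finset.mem_image, Finset.mem_filter, Finset.mem_univ, true_and] at he
    obtain ⟨q, hq, rfl⟩ := he
    simpa using hq.1
  · intro H hH
    obtain ⟨f, S, hf, hfS⟩ := exists_blocks_of_pathGraph_free hn hH hb
    refine ⟨Φ (f, S), ?_, ?_⟩
    · simp only [Finset.mem_filter, Finset.mem_image, Finset.mem_univ, true_and]
      refine ⟨⟨_, rfl⟩, Finset.card_image_le.trans ?_⟩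
      have hsub : pairs (f, S) ⊆ (Finset.univ : Finset V).biUnion fun u =>
          ((Finset.univ.filter (f · = f u)) ∪ (S (f u)).1).image fun v => (u, v) := by
        rintro ⟨u, v⟩ hq
        simp only [pairs, Finset.mem_filter, Finset.mem_univ, true_and] at hq
        simp only [Finset.mem_biUnion, Finset.mem_univ, true_and, Finset.mem_image,
          Finset.mem_union, Finset.mem_filter, Prod.mk.injEq]
        exact ⟨u, v, hq.2.imp Eq.symm id, rfl, rfl⟩
      refine (Finset.card_le_card hsub).trans ?_
      rw [mul_comm, ← Finset.card_univ]
      refine Finset.card_biUnion_le_card_mul _ _ _ fun u _ => ?_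
      refine Finset.card_image_le.trans ((Finset.card_union_le _ _).trans ?_)
      have := hf (f u)
      have := (S (f u)).2
      omega
    · intro e he
      induction e using Sym2.inductionOn with
      | _ u v =>
      rw [mem_edgeSet] at he
      simp only [Φ, pairs, Finset.coe_image, Set.mem_image, Finset.mem_coe, Finset.mem_filter,
        Finset.mem_univ, true_and]
      rcases hfS u v he with h | h
      · exact ⟨(u, v), ⟨he.ne, h⟩, rfl⟩
      · exact ⟨(v, u), ⟨he.ne.symm, h⟩, Sym2.eq_swap⟩

end Containers

/-! ### Edges per colour. -/

section MinColors

/-- Giving all edges distinct colours is admissible, since for n ≥ 2 the path has two edges. Hence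
the infimum is attained and is not the default `sInf ∅ = 0`. -/
lemma exists_edgeLabeling_minColors {V : Type*} [Finite V] (G : SimpleGraph V) {n : ℕ}
    (hn : 2 ≤ n) :
    ∃ C : G.EdgeLabeling (Fin (G.minColors (pathGraph (n + 1)))),
      ∀ i, (pathGraph (n + 1)).Free (C.labelGraph i) := by
  refine Nat.sInf_mem (s := {k : ℕ | ∃ C : G.EdgeLabeling (Fin k),
    ∀ i : Fin k, (pathGraph (n + 1)).Free (C.labelGraph i)}) ?_
  obtain ⟨k, ⟨φ⟩⟩ := Finite.exists_equiv_fin G.edgeSet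
  let C : G.EdgeLabeling (Fin k) := fun e => φ e
  refine ⟨k, C, fun i hi => ?_⟩
  obtain ⟨c⟩ := hi
  have h01 := c.toHom.map_adj (v := (⟨0, by omega⟩ : Fin (n + 1))) (w := ⟨1, by omega⟩)
    (pathGraph_adj.2 (.inl rfl))
  have h12 := c.toHom.map_adj (v := (⟨1, by omega⟩ : Fin (n + 1))) (w := ⟨2, by omega⟩)
    (pathGraph_adj.2 (.inl rfl))
  obtain ⟨e, he⟩ := (EdgeLabeling.labelGraph_adj _ _).1 h01
  obtain ⟨e', he'⟩ := (EdgeLabeling.labelGraph_adj _ _).1 h12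
  rcases Sym2.eq_iff.1 (congrArg Subtype.val (φ.injective (he.trans he'.symm))) with h | h
  · have := c.injective h.1
    simp at this
  · have := c.injective h.1
    simp at this

/-- If every subgraph of `G` without a path on `n + 1` vertices has at most `M` edges, then `G` has
at most `M` times as many edges as colours are needed. -/
lemma ncard_edgeSet_le_minColors_mul {V : Type*} [Finite V] {G : SimpleGraph V} {n : ℕ}
    (hn : 2 ≤ n) {M : ℝ}
    (hM : ∀ H ≤ G, (pathGraph (n + 1)).Free H → (H.edgeSet.ncard : ℝ) ≤ M) :
    (G.edgeSet.ncard : ℝ) ≤ G.minColors (pathGraph (n + 1)) * M := by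
  classical
  obtain ⟨C, hC⟩ := exists_edgeLabeling_minColors G hn
  have hG : G.edgeSet ⊆ ⋃ i ∈ (Finset.univ : Finset (Fin (G.minColors (pathGraph (n + 1))))),
      (C.labelGraph i).edgeSet := by
    intro e he
    induction e using Sym2.inductionOn with
    | _ u v =>
    simp only [Finset.mem_univ, Set.iUnion_true, Set.mem_iUnion, mem_edgeSet]
    exact ⟨C ⟨s(u, v), he⟩, (EdgeLabeling.labelGraph_adj u v).2 ⟨he, rfl⟩⟩
  have h1 : G.edgeSet.ncard ≤ ∑ i, (C.labelGraph i).edgeSet.ncard :=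
    (Set.ncard_le_ncard hG (Set.toFinite _)).trans (Finset.set_ncard_biUnion_le _ _)
  calc (G.edgeSet.ncard : ℝ) ≤ ∑ i, ((C.labelGraph i).edgeSet.ncard : ℝ) := by exact_mod_cast h1
    _ ≤ ∑ _i : Fin (G.minColors (pathGraph (n + 1))), M :=
        Finset.sum_le_sum fun i _ => hM _ C.labelGraph_le (hC i)
    _ = _ := by simp

end MinColors

end SimpleGraph

namespace SimpleGraph

/-! ### Chernoff bounds and counting small sets. -/

section Concentration

open MeasureTheory

variable {V : Type*} [Fintype V]

open Classical in
/-- The number of edges of `G` that belong to `E`. -/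
noncomputable def edgeCount (E : Finset (Sym2 V)) (G : SimpleGraph V) : ℕ :=
  (E.filter (· ∈ G.edgeSet)).card

lemma ncard_edgeSet_le_edgeCount {H G : SimpleGraph V} {E : Finset (Sym2 V)} (hHG : H ≤ G)
    (hHE : H.edgeSet ⊆ E) : H.edgeSet.ncard ≤ edgeCount E G := by
  classical
  rw [edgeCount, ← Set.ncard_coe_finset]
  refine Set.ncard_le_ncard (fun e he => ?_) (Set.toFinite _)
  simpa using ⟨hHE he, edgeSet_mono hHG he⟩

instance instMeasurableSingletonClassOfFintype : MeasurableSingletonClass (SimpleGraph V) :=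
  ⟨fun G => by
    have h := measurable_edgeSet (measurableSet_singleton G.edgeSet)
    rwa [← Set.image_singleton, Set.preimage_image_eq _ edgeSet_injective] at h⟩

lemma measureReal_binomialRandom_singleton (p : I) (G : SimpleGraph V) :
    (binomialRandom V p).real {G} =
      (p : ℝ) ^ G.edgeSet.ncard * (1 - p) ^ ((Nat.card V).choose 2 - G.edgeSet.ncard) := by
  rw [measureReal_def, binomialRandom_singleton]
  simp

/-- The probability generating function of the number of edges of a binomial random graph in a
given set of pairs. -/
lemma integral_pow_edgeCount (p : I) {E : Finset (Sym2 V)} (hE : ∀ e ∈ E, ¬ e.IsDiag) (a : ℝ) :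
    ∫ G, a ^ edgeCount E G ∂binomialRandom V p = (1 + p * (a - 1)) ^ E.card := by
  classical
  have : Fintype (SimpleGraph V) := Fintype.ofFinite _
  let T : Finset (Sym2 V) := Finset.univ.filter fun e => ¬ e.IsDiag
  have hT : T.card = (Nat.card V).choose 2 := by
    rw [Nat.card_eq_fintype_card, ← Sym2.card_subtype_not_diag, Fintype.card_subtype]
  have hET : E ⊆ T := fun e he => by simpa [T] using hE e he
  rw [integral_fintype .of_finite]
  -- Graphs correspond to subsets of the off-diagonal pairs `T`, so the sum is the expansion of a
  -- product of two-term factors over `T`.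
  have hsum : ∑ G : SimpleGraph V, (binomialRandom V p).real {G} • a ^ edgeCount E G =
      ∑ s ∈ T.powerset, (∏ e ∈ s, (p : ℝ) * (if e ∈ E then a else 1)) *
        ∏ e ∈ T \ s, (1 - (p : ℝ)) := by
    refine Finset.sum_bij' (fun G _ => G.edgeFinset) (fun s _ => fromEdgeSet (s : Set (Sym2 V)))
      ?_ ?_ ?_ ?_ ?_
    · intro G _
      simp only [Finset.mem_powerset]
      intro e he
      simp only [T, Finset.mem_filter, Finset.mem_univ, true_and]
      exact G.not_isDiag_of_mem_edgeFinset he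
    · simp
    · simp
    · intro s hs
      rw [Finset.mem_powerset] at hs
      ext e
      simp only [mem_edgeFinset, edgeSet_fromEdgeSet, Set.mem_sdiff, Finset.mem_coe]
      refine ⟨fun h => h.1, fun h => ⟨h, ?_⟩⟩
      have := hs h
      simpa [T] using this
    · intro G _
      have hsub : G.edgeFinset ⊆ T := by
        intro e he
        simp only [T, Finset.mem_filter, Finset.mem_univ, true_and]
        exact G.not_isDiag_of_mem_edgeFinset he
      rw [measureReal_binomialRandom_singleton, Finset.prod_mul_distrib, Finset.prod_const,
        Finset.prod_const, Finset.card_sdiff_of_subset hsub, hT, Finset.prod_ite,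
        Finset.prod_const, Finset.prod_const_one, mul_one, smul_eq_mul, edgeCount]
      have : E.filter (· ∈ G.edgeSet) = G.edgeFinset.filter (· ∈ E) := by
        ext e
        simp [and_comm]
      have hcard : G.edgeSet.ncard = G.edgeFinset.card := by
        rw [← coe_edgeFinset, Set.ncard_coe_finset]
      rw [this, hcard]
      ring
  rw [hsum, ← Finset.prod_add]
  have hterm : ∀ e ∈ T, (p : ℝ) * (if e ∈ E then a else 1) + (1 - p) =
      if e ∈ E then 1 + p * (a - 1) else 1 := by
    intro e _
    split_ifs <;> ring
  rw [Finset.prod_congr rfl hterm, Finset.prod_ite, Finset.prod_const, Finset.prod_const_one,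
    mul_one, Finset.filter_mem_eq_inter, Finset.inter_eq_right.2 hET]

/-- The Chernoff bound for both tails: the upper one for `1 ≤ a`, the lower one for `a ≤ 1`. -/
lemma measureReal_edgeCount_le (p : I) {E : Finset (Sym2 V)} (hE : ∀ e ∈ E, ¬ e.IsDiag) {a : ℝ}
    (ha : 0 < a) (M : ℝ) :
    (binomialRandom V p).real {G | M * Real.log a ≤ edgeCount E G * Real.log a} ≤
      Real.exp (p * (a - 1) * E.card - M * Real.log a) := by
  have hp0 : (0 : ℝ) ≤ p := p.2.1
  have hp1 : (p : ℝ) ≤ 1 := p.2.2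
  have hset : {G : SimpleGraph V | M * Real.log a ≤ edgeCount E G * Real.log a} =
      {G | Real.exp (M * Real.log a) ≤ a ^ edgeCount E G} := by
    ext G
    simp only [Set.mem_ofPred_eq]
    rw [← Real.exp_le_exp, ← Real.log_pow, Real.exp_log (pow_pos ha _)]
  have hmarkov := mul_meas_ge_le_integral_of_nonneg (μ := binomialRandom V p)
    (f := fun G => a ^ edgeCount E G) (ae_of_all _ fun G => (pow_pos ha _).le) .of_finite
    (Real.exp (M * Real.log a))
  rw [integral_pow_edgeCount p hE, ← hset] at hmarkov
  have hpow : (1 + p * (a - 1)) ^ E.card ≤ Real.exp (p * (a - 1) * E.card) := by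
    rw [mul_comm _ (E.card : ℝ), Real.exp_nat_mul]
    refine pow_le_pow_left₀ (by nlinarith) ?_ _
    linarith [Real.add_one_le_exp ((p : ℝ) * (a - 1))]
  rw [Real.exp_sub, le_div_iff₀ (Real.exp_pos _), mul_comm]
  exact hmarkov.trans hpow

/-- Few edges are unlikely. -/
lemma measureReal_ncard_edgeSet_le (p : I) :
    (binomialRandom V p).real
        {G | (G.edgeSet.ncard : ℝ) ≤ p * (Fintype.card V).choose 2 / 2} ≤
      Real.exp (-(p * (Fintype.card V).choose 2 / 8)) := by
  classical
  let T : Finset (Sym2 V) := Finset.univ.filter fun e => ¬ e.IsDiag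
  have hT : T.card = (Fintype.card V).choose 2 := by
    rw [← Sym2.card_subtype_not_diag, Fintype.card_subtype]
  have hcount : ∀ G : SimpleGraph V, edgeCount T G = G.edgeSet.ncard := by
    intro G
    rw [edgeCount, ← Set.ncard_coe_finset]
    congr 1
    ext e
    simp only [T, Finset.coe_filter, Finset.mem_filter, Finset.mem_univ, true_and,
      Set.mem_ofPred_eq, and_iff_right_iff_imp]
    exact G.not_isDiag_of_mem_edgeSet
  have hlog : Real.log (1 / 2) = -Real.log 2 := by rw [one_div, Real.log_inv]
  have hlog2 := Real.log_two_lt_d9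
  have hlog2' := Real.log_two_gt_d9
  have h := measureReal_edgeCount_le p (E := T) (by simp [T]) (a := 1 / 2) (by norm_num)
    (p * (Fintype.card V).choose 2 / 2)
  have hset : {G : SimpleGraph V | (G.edgeSet.ncard : ℝ) ≤ (p : ℝ) * (Fintype.card V).choose 2 / 2} =
      {G | (p : ℝ) * (Fintype.card V).choose 2 / 2 * Real.log (1 / 2) ≤
        edgeCount T G * Real.log (1 / 2)} := by
    ext G
    simp only [Set.mem_ofPred_eq, hcount]
    exact (mul_le_mul_right_of_neg (by rw [hlog]; linarith)).symm
  rw [hset]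
  refine h.trans (Real.exp_le_exp.2 ?_)
  rw [hT, hlog]
  have : (0 : ℝ) ≤ p * (Fintype.card V).choose 2 := mul_nonneg p.2.1 (by positivity)
  nlinarith

/-- The number of sets of at most `n` elements is at most `(eN/n)ⁿ`. -/
lemma card_finset_card_le_le {n : ℕ} (hn : 0 < n) (hnV : n ≤ Fintype.card V) :
    (Fintype.card {s : Finset V // s.card ≤ n} : ℝ) ≤
      Real.exp (n * (1 + Real.log ((Fintype.card V : ℝ) / n))) := by
  classical
  set N := Fintype.card V with hN
  have hn' : (0 : ℝ) < n := by exact_mod_cast hn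
  have hN' : (0 : ℝ) < N := by exact_mod_cast hn.trans_le hnV
  set x : ℝ := n / N with hx
  have hx0 : 0 < x := by positivity
  have hx1 : x ≤ 1 := (div_le_one hN').2 (by exact_mod_cast hnV)
  -- Weight each set `s` by `x ^ s.card`: as `x ≤ 1`, small sets weigh at least `x ^ n`, and the
  -- total weight is `(x + 1) ^ N`.
  have h1 : (Fintype.card {s : Finset V // s.card ≤ n} : ℝ) * x ^ n ≤ (x + 1) ^ N := by
    have hb : (x + 1) ^ N = ∑ s : Finset V, x ^ s.card := by
      have := Finset.prod_add (fun _ : V => x) (fun _ => 1) Finset.univ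
      simpa [Finset.card_univ] using this
    rw [hb, Fintype.card_subtype, ← nsmul_eq_mul, ← Finset.sum_const]
    refine le_trans (Finset.sum_le_sum fun s hs => ?_)
      (Finset.sum_le_sum_of_subset_of_nonneg (Finset.filter_subset _ _)
        fun s _ _ => (pow_pos hx0 _).le)
    exact pow_le_pow_of_le_one hx0.le hx1 (Finset.mem_filter.1 hs).2
  have h2 : (x + 1) ^ N ≤ Real.exp n := by
    calc (x + 1) ^ N ≤ Real.exp x ^ N :=
          pow_le_pow_left₀ (by positivity) (Real.add_one_le_exp x) _
      _ = Real.exp n := by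
          rw [← Real.exp_nat_mul, hx]
          congr 1
          field_simp
  have h3 : Real.exp (n * (1 + Real.log ((N : ℝ) / n))) * x ^ n = Real.exp n := by
    have : x ^ n = Real.exp (n * Real.log x) := by
      rw [← Real.log_pow, Real.exp_log (pow_pos hx0 _)]
    rw [this, ← Real.exp_add, hx, ← inv_div (N : ℝ), Real.log_inv]
    congr 1
    ring
  exact le_of_mul_le_mul_right ((h1.trans h2).trans h3.ge) (pow_pos hx0 n)

end Concentration

end SimpleGraph

namespace SimpleGraph

/-! ### Union bound and the number of colours. -/

section ColourBound

open MeasureTheory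

variable {V : Type*} [Fintype V]

lemma log_le_sqrt {x : ℝ} (hx : 0 < x) : Real.log x ≤ √x := by
  have hs : 0 < √x := Real.sqrt_pos.2 hx
  have he : (2 : ℝ) ≤ Real.exp 1 := by linarith [Real.add_one_le_exp (1 : ℝ)]
  have h1 : Real.log (√x / Real.exp 1) ≤ √x / Real.exp 1 - 1 :=
    Real.log_le_sub_one_of_pos (by positivity)
  rw [Real.log_div hs.ne' (Real.exp_pos _).ne', Real.log_exp, Real.log_sqrt hx.le] at h1
  have h2 : √x / Real.exp 1 ≤ √x / 2 := by gcongr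
  linarith

/-- With high probability, every subgraph of a sparse binomial random graph that has no path on
`n + 1` vertices has few edges. -/
lemma measureReal_exists_pathGraph_free_le {n : ℕ} (hn : 0 < n) (p : I) {r ω : ℝ}
    (hr : r = (Fintype.card V : ℝ) / n) (hr120 : 120 ≤ r) (hω : 34 ≤ ω)
    (hpω : (n : ℝ) * p * ω = Real.log r) :
    (binomialRandom V p).real {G | ∃ H ≤ G, (pathGraph (n + 1)).Free H ∧
        11 / 2 * (Fintype.card V * Real.log r / Real.log ω) < H.edgeSet.ncard} ≤
      Real.exp (-(Fintype.card V / 4)) := by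
  classical
  have hn' : (0 : ℝ) < n := by exact_mod_cast hn
  have hp0 : (0 : ℝ) ≤ p := p.2.1
  have hNr : (Fintype.card V : ℝ) = r * n := by rw [hr]; field_simp
  have hnN : n ≤ Fintype.card V := by
    have : (n : ℝ) ≤ Fintype.card V := by rw [hNr]; nlinarith
    exact_mod_cast this
  set M : ℝ := 11 / 2 * (Fintype.card V * Real.log r / Real.log ω) with hM
  have hω0 : 0 < ω := by linarith
  have hs5 : 5 ≤ √ω := Real.le_sqrt_of_sq_le (by linarith)
  have hlogω : 0 < Real.log ω := Real.log_pos (by linarith)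
  have hlogs : Real.log √ω = Real.log ω / 2 := Real.log_sqrt hω0.le
  have hlogr : 4 ≤ Real.log r := by
    rw [Real.le_log_iff_exp_le (by linarith)]
    have h1 : Real.exp 4 = Real.exp 1 ^ 4 := by rw [← Real.exp_nat_mul]; norm_num
    have h2 : Real.exp 1 ^ 4 ≤ 3 ^ 4 :=
      pow_le_pow_left₀ (Real.exp_pos _).le (by linarith [Real.exp_one_lt_d9]) 4
    rw [h1]
    linarith
  set b : ℕ := ⌈r⌉₊ with hb
  have hbr : r ≤ b := Nat.le_ceil r
  have hbr' : (b : ℝ) ≤ r + 1 := (Nat.ceil_lt_add_one (by linarith)).le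
  have hbN : Fintype.card V ≤ b * n := by
    have : (Fintype.card V : ℝ) ≤ b * n := by rw [hNr]; gcongr
    exact_mod_cast this
  obtain ⟨𝓔, hcard, h𝓔, hcont⟩ := exists_containers V hn hbN
  have hsub : {G : SimpleGraph V | ∃ H ≤ G, (pathGraph (n + 1)).Free H ∧
      M < H.edgeSet.ncard} ⊆
      ⋃ E ∈ 𝓔, {G | M * Real.log √ω ≤ edgeCount E G * Real.log √ω} := by
    rintro G ⟨H, hHG, hH, hMH⟩
    obtain ⟨E, hE, hHE⟩ := hcont H hH
    simp only [Set.mem_iUnion, Set.mem_ofPred_eq]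
    refine ⟨E, hE, mul_le_mul_of_nonneg_right (hMH.le.trans ?_) (by rw [hlogs]; linarith)⟩
    exact_mod_cast ncard_edgeSet_le_edgeCount hHG hHE
  -- Chernoff with a = √ω: the gain is 11/4 and, as √ω ≥ 5, the loss at most 2/5, in units of N log
  -- r; 11/4 - 2/5 = 47/20.
  have hone : ∀ E ∈ 𝓔, (binomialRandom V p).real
      {G | M * Real.log √ω ≤ edgeCount E G * Real.log √ω} ≤
        Real.exp (-(47 / 20) * (Fintype.card V * Real.log r)) := by
    intro E hE
    refine (measureReal_edgeCount_le p (h𝓔 E hE).2 (by linarith) M).trans (Real.exp_le_exp.2 ?_)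
    have h1 : (E.card : ℝ) ≤ 2 * n * Fintype.card V := by exact_mod_cast (h𝓔 E hE).1
    have h2 : M * Real.log √ω = 11 / 4 * (Fintype.card V * Real.log r) := by
      rw [hlogs, hM]
      linear_combination 11 / 4 * div_mul_cancel₀ (Fintype.card V * Real.log r) hlogω.ne'
    have h3 : (n : ℝ) * p * √ω ≤ Real.log r / 5 := by
      have : (n : ℝ) * p * √ω * √ω = Real.log r := by
        rw [mul_assoc, Real.mul_self_sqrt hω0.le, hpω]
      have h0 : 0 ≤ (n : ℝ) * p * √ω := by positivity
      nlinarith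
    have h4 : p * (√ω - 1) * E.card ≤ p * √ω * (2 * n * Fintype.card V) := by
      refine mul_le_mul (mul_le_mul_of_nonneg_left ?_ hp0) h1 (Nat.cast_nonneg _)
        (by positivity)
      linarith
    have h5 : p * √ω * (2 * n * Fintype.card V) ≤ 2 / 5 * (Fintype.card V * Real.log r) := by
      have := mul_le_mul_of_nonneg_left h3 (by positivity : (0 : ℝ) ≤ 2 * Fintype.card V)
      linarith
    rw [h2]
    linarith
  have hcard' : (𝓔.card : ℝ) ≤ Real.exp (Fintype.card V * Real.log r + n +
      (Fintype.card V + n) * (1 + Real.log r)) := by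
    have h1 : (𝓔.card : ℝ) ≤ (b : ℝ) ^ Fintype.card V *
        (Fintype.card {s : Finset V // s.card ≤ n} : ℝ) ^ b := by exact_mod_cast hcard
    have h2 : (b : ℝ) ^ Fintype.card V ≤ Real.exp (Fintype.card V * Real.log r + n) := by
      -- Rounding r up costs only a factor 1 + 1/r ≤ exp(1/r), and N/r = n.
      have hb' : (b : ℝ) ≤ Real.exp (Real.log r + 1 / r) := by
        rw [Real.exp_add, Real.exp_log (by linarith)]
        have := mul_le_mul_of_nonneg_left (Real.add_one_le_exp (1 / r))
          (by linarith : (0 : ℝ) ≤ r)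
        have h : r * (1 / r + 1) = r + 1 := by field_simp; ring
        linarith
      calc (b : ℝ) ^ Fintype.card V ≤ Real.exp (Real.log r + 1 / r) ^ Fintype.card V :=
            pow_le_pow_left₀ (by positivity) hb' _
        _ = _ := by
            rw [← Real.exp_nat_mul]
            congr 1
            rw [hNr]
            field_simp
    have h3 : (Fintype.card {s : Finset V // s.card ≤ n} : ℝ) ^ b ≤
        Real.exp ((Fintype.card V + n) * (1 + Real.log r)) := by
      have h := card_finset_card_le_le (V := V) hn hnN
      rw [← hr] at h
      calc _ ≤ Real.exp (n * (1 + Real.log r)) ^ b := pow_le_pow_left₀ (by positivity) h _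
        _ = Real.exp (b * n * (1 + Real.log r)) := by
            rw [← Real.exp_nat_mul, mul_assoc]
        _ ≤ _ := by
            refine Real.exp_le_exp.2 (mul_le_mul_of_nonneg_right ?_ (by linarith))
            rw [hNr]
            nlinarith
    rw [Real.exp_add]
    exact h1.trans (mul_le_mul h2 h3 (by positivity) (Real.exp_pos _).le)
  calc _ ≤ (binomialRandom V p).real
        (⋃ E ∈ 𝓔, {G | M * Real.log √ω ≤ edgeCount E G * Real.log √ω}) :=
        measureReal_mono hsub (measure_ne_top _ _)
    _ ≤ ∑ E ∈ 𝓔, (binomialRandom V p).real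
        {G | M * Real.log √ω ≤ edgeCount E G * Real.log √ω} :=
        measureReal_biUnion_finset_le _ _
    _ ≤ 𝓔.card * Real.exp (-(47 / 20) * (Fintype.card V * Real.log r)) := by
        rw [← nsmul_eq_mul]
        exact Finset.sum_le_card_nsmul _ _ _ hone
    _ ≤ Real.exp (Fintype.card V * Real.log r + n + (Fintype.card V + n) * (1 + Real.log r)) *
        Real.exp (-(47 / 20) * (Fintype.card V * Real.log r)) := by gcongr
    _ ≤ Real.exp (-(Fintype.card V / 4)) := by
        rw [← Real.exp_add]
        refine Real.exp_le_exp.2 ?_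
        -- The exponent is -(7/20) N log r + N + 2n + n log r; n ≤ N/120 and log r ≥ 4 make it at
        -- most -N/4.
        have h1 : 120 * (n : ℝ) ≤ Fintype.card V := by rw [hNr]; gcongr
        have h2 : 120 * ((n : ℝ) * Real.log r) ≤ Fintype.card V * Real.log r := by
          have := mul_le_mul_of_nonneg_right h1 (by linarith : 0 ≤ Real.log r)
          linarith
        have h3 : (Fintype.card V : ℝ) * 4 ≤ Fintype.card V * Real.log r := by gcongr
        linarith

/-- The probability that few colours suffice. -/
lemma measureReal_minColors_lt_le {n : ℕ} (hn : 2 ≤ n) (hN : 12 ≤ Fintype.card V) (p : I)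
    {r ω : ℝ} (hr : r = (Fintype.card V : ℝ) / n) (hp : 0 < (p : ℝ)) (hω : 34 ≤ ω)
    (hpω : (n : ℝ) * p * ω = Real.log r) :
    (binomialRandom V p).real
        {G | (G.minColors (pathGraph (n + 1)) : ℝ) < Real.log ω / (24 * ω) * r} ≤
      Real.exp (-(p * (Fintype.card V).choose 2 / 8)) + Real.exp (-(Fintype.card V / 4)) := by
  have hn' : (0 : ℝ) < n := by positivity
  have hN' : (12 : ℝ) ≤ Fintype.card V := by exact_mod_cast hN
  have hNr : (Fintype.card V : ℝ) = r * n := by rw [hr]; field_simp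
  have hr0 : 0 < r := by rw [hr]; positivity
  have hω0 : 0 < ω := by linarith
  have hlogω : 0 < Real.log ω := Real.log_pos (by linarith)
  have hlogr : 0 < Real.log r := by rw [← hpω]; positivity
  have hchoose : (((Fintype.card V).choose 2 : ℕ) : ℝ) =
      Fintype.card V * (Fintype.card V - 1) / 2 := Nat.cast_choose_two ℝ _
  have hchoose_pos : 0 < p * (((Fintype.card V).choose 2 : ℕ) : ℝ) := by
    rw [hchoose]
    have : (0 : ℝ) < Fintype.card V - 1 := by linarith
    positivity
  rcases lt_or_ge r 120 with hr120 | hr120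
  · refine le_trans (measureReal_mono ?_) ((measureReal_ncard_edgeSet_le p).trans
      (le_add_of_nonneg_right (Real.exp_pos _).le))
    intro G hG
    simp only [Set.mem_ofPred_eq] at hG ⊢
    -- Here log ω / ω ≤ 1/5 and r/24 < 5.
    have h1 : Real.log ω / (24 * ω) * r < 1 := by
      have hs5 : 5 ≤ √ω := Real.le_sqrt_of_sq_le (by linarith)
      have h2 : 5 * Real.log ω ≤ ω := by
        have h3 := log_le_sqrt hω0
        have h4 := Real.mul_self_sqrt hω0.le
        nlinarith
      rw [div_mul_eq_mul_div, div_lt_one (by positivity)]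
      nlinarith
    have hzero : G.minColors (pathGraph (n + 1)) = 0 := by
      have : (G.minColors (pathGraph (n + 1)) : ℝ) < 1 := hG.trans h1
      exact Nat.lt_one_iff.1 (by exact_mod_cast this)
    have h2 := ncard_edgeSet_le_minColors_mul (G := G) hn (M := G.edgeSet.ncard)
      fun H hH _ => by
        exact_mod_cast Set.ncard_le_ncard (edgeSet_mono hH) (Set.toFinite _)
    rw [hzero, Nat.cast_zero, zero_mul] at h2
    linarith
  · refine le_trans ((measureReal_mono ?_).trans (measureReal_union_le _ _))
      (add_le_add (measureReal_ncard_edgeSet_le p)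
        (measureReal_exists_pathGraph_free_le (by omega) p hr hr120 hω hpω))
    intro G hG
    by_contra hcon
    simp only [Set.mem_union, Set.mem_ofPred_eq, not_or, not_le, not_exists, not_and, not_lt]
      at hcon hG
    obtain ⟨hlow, hup⟩ := hcon
    have h1 := ncard_edgeSet_le_minColors_mul (G := G) hn hup
    have h2 : Real.log ω / (24 * ω) * r * (11 / 2 * (Fintype.card V * Real.log r / Real.log ω)) =
        11 / 48 * (p * (Fintype.card V : ℝ) ^ 2) := by
      rw [← hpω, hNr]
      field_simp
      ring
    have h3 := mul_lt_mul_of_pos_right hG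
      (by positivity : 0 < 11 / 2 * (Fintype.card V * Real.log r / Real.log ω))
    rw [h2] at h3
    -- The slack between 11/48 and 1/4 absorbs replacing N(N-1) by N² once N ≥ 12.
    have h4 : 11 / 48 * (p * (Fintype.card V : ℝ) ^ 2) ≤
        p * (((Fintype.card V).choose 2 : ℕ) : ℝ) / 2 := by
      rw [hchoose]
      have : 0 ≤ (p : ℝ) * Fintype.card V * (Fintype.card V - 12) :=
        mul_nonneg (by positivity) (by linarith)
      linarith
    linarith

end ColourBound

end SimpleGraph

/-! ### Passage to the limit. -/

theorem theorem5p5 (N : ℕ → ℕ) (p : ℕ → I)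
    (hN : ∀ᶠ n : ℕ in atTop, n < N n)
    (hp : ∀ᶠ n : ℕ in atTop, (p n : ℝ) ≤ Real.log ((N n : ℝ) / n) / (34 * n))
    (hp_low : Tendsto (fun n : ℕ => (p n : ℝ) * (N n : ℝ) ^ 2) atTop atTop) :
    Tendsto
      (fun n : ℕ =>
        SimpleGraph.binomialRandom (Fin (N n)) (p n)
          {G : SimpleGraph (Fin (N n)) |
            let r : ℝ := (N n : ℝ) / n
            let ω : ℝ := Real.log r / (n * p n)
            Real.log ω / (24 * ω) * r ≤ (G.minColors (SimpleGraph.pathGraph (n + 1)) : ℝ)})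
      atTop (𝓝 1) := by
  have hNtop : Tendsto (fun n => (N n : ℝ)) atTop atTop :=
    tendsto_atTop_mono' atTop (hN.mono fun n hn => Nat.cast_le.2 hn.le)
      tendsto_natCast_atTop_atTop
  have hbad : Tendsto (fun n => 1 - (Real.exp (-((p n : ℝ) * (N n : ℝ) ^ 2 / 32)) +
      Real.exp (-((N n : ℝ) / 4)))) atTop (𝓝 1) := by
    have h1 : Tendsto (fun n => Real.exp (-((p n : ℝ) * (N n : ℝ) ^ 2 / 32))) atTop (𝓝 0) :=
      Real.tendsto_exp_neg_atTop_nhds_zero.comp (hp_low.atTop_div_const (by norm_num))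
    have h2 : Tendsto (fun n => Real.exp (-((N n : ℝ) / 4))) atTop (𝓝 0) :=
      Real.tendsto_exp_neg_atTop_nhds_zero.comp (hNtop.atTop_div_const (by norm_num))
    simpa using (h1.add h2).const_sub 1
  refine (ENNReal.tendsto_toReal_iff (fun n => MeasureTheory.measure_ne_top _ _) (by simp)).1 ?_
  rw [ENNReal.toReal_one]
  refine tendsto_of_tendsto_of_tendsto_of_le_of_le' hbad tendsto_const_nhds ?_
    (Eventually.of_forall fun n => MeasureTheory.measureReal_le_one)
  filter_upwards [hN, hp, hp_low.eventually_gt_atTop 0, eventually_ge_atTop 12]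
    with n hNn hpn hpos hn
  have hn' : (0 : ℝ) < n := by positivity
  have hNn' : (n : ℝ) < N n := by exact_mod_cast hNn
  have hn12 : (12 : ℝ) ≤ n := by exact_mod_cast hn
  -- This excludes p = 0, where the division defining ω would give the default value 0.
  have hp0 : 0 < (p n : ℝ) := pos_of_mul_pos_left hpos (by positivity)
  set r : ℝ := (N n : ℝ) / n with hr
  set ω : ℝ := Real.log r / (n * p n) with hωdef
  have hω : 34 ≤ ω := by
    rw [hωdef, le_div_iff₀ (by positivity)]
    rw [le_div_iff₀ (by positivity)] at hpn
    linarith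
  have hpω : (n : ℝ) * p n * ω = Real.log r := by
    rw [hωdef]
    field_simp
  have hmain := SimpleGraph.measureReal_minColors_lt_le (V := Fin (N n)) (n := n) (by omega)
    (by rw [Fintype.card_fin]; omega) (p n) (r := r) (by rw [Fintype.card_fin]) hp0 hω hpω
  rw [Fintype.card_fin, Nat.cast_choose_two] at hmain
  have hcompl : {G : SimpleGraph (Fin (N n)) |
      Real.log ω / (24 * ω) * r ≤ (G.minColors (SimpleGraph.pathGraph (n + 1)) : ℝ)} =
      {G | (G.minColors (SimpleGraph.pathGraph (n + 1)) : ℝ) < Real.log ω / (24 * ω) * r}ᶜ := by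
    ext G
    simp
  change _ ≤ (SimpleGraph.binomialRandom (Fin (N n)) (p n)).real {G : SimpleGraph (Fin (N n)) |
      Real.log ω / (24 * ω) * r ≤ (G.minColors (SimpleGraph.pathGraph (n + 1)) : ℝ)}
  rw [hcompl, MeasureTheory.probReal_compl_eq_one_sub (Set.toFinite _).measurableSet]
  have hexp : Real.exp (-((p n : ℝ) * (N n * (N n - 1) / 2) / 8)) ≤
      Real.exp (-((p n : ℝ) * (N n : ℝ) ^ 2 / 32)) := by
    refine Real.exp_le_exp.2 ?_
    have : 0 ≤ (p n : ℝ) * N n * (N n - 2) := mul_nonneg (by positivity) (by linarith)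
    linarith
  linarith
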